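/- An mm-space is a complete separable metric space $(X,d_X)$ together with a Borel probability measure $\mu_X$. A parameter of $X$ is a Borel map $\varphi:[0,1)\to X$ with $\varphi_*\mathcal L^1=\mu_X$, where $\mathcal L^1$ is the Lebesgue measure on $[0,1)$. The box distance $\square(X,Y)$ between two mm-spaces is the infimum of all $\varepsilon\ge 0$ for which there are parameters $\varphi$ of $X$ and $\psi$ of $Y$ and a Borel set $I_0\subset[0,1)$ with $\mathcal L^1(I_0)\ge 1-\varepsilon$ and $|d_X(\varphi(s),\varphi(t))-d_Y(\psi(s),\psi(t))|\le\varepsilon$ for all $s,t\in I_0$. For $n\ge 1$ and $r>0$ let $S^n(r)\subset\mathbb R^{n+1}$ be the sphere of radius $r$ centered at the origin, with its normalized volume measure and with either the restriction of the Euclidean distance or the Riemannian distance. Let $\mathbb{C}P^n(r)=S^{2n+1}(r)/S^1$ be the quotient of $S^{2n+1}(r)\subset\mathbb C^{n+1}$ by the Hopf action (scalar multiplication by unit complex numbers), with the push-forward measure and with the distance between two orbits given by the infimum of the distances between their points, for either of the two distances on $S^{2n+1}(r)$. Proposition. Let $\{r_n\}_{n=1}^\infty$ be a sequence of positive real numbers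 that is bounded away from zero, i.e. there is $c>0$ with $r_n\ge c$ for all $n$. Then neither $\{S^n(r_n)\}_{n=1}^\infty$ nor $\{\mathbb{C}P^n(r_n)\}_{n=1}^\infty$ has a subsequence that converges to an mm-space with respect to the box distance $\square$. This holds for both choices of the distance. -/

import Mathlib

open MeasureTheory Set Filter Topology
open scoped ENNReal NNReal

noncomputable section

namespace MMGeom

universe u v

/-! ### Metric measure spaces and the box distance -/

/-- An mm-space: a complete separable metric space with a Borel probability measure. -/
structure MMSpace : Type (u + 1) where
  /-- the underlying set -/
  carrier : Type u
  [metric : MetricSpace carrier]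
  [complete : CompleteSpace carrier]
  [separable : TopologicalSpace.SeparableSpace carrier]
  [measurable : MeasurableSpace carrier]
  [borel : BorelSpace carrier]
  /-- the measure -/
  μ : Measure carrier
  [prob : IsProbabilityMeasure μ]

attribute [instance] MMSpace.metric MMSpace.complete MMSpace.separable MMSpace.measurable
  MMSpace.borel MMSpace.prob

/-- The Lebesgue measure on the interval `[0,1)`. -/
abbrev lebesgueIco : Measure (Ico (0 : ℝ) 1) :=
  (volume : Measure ℝ).comap Subtype.val

/-- A parameter of `X`: a Borel map `φ : [0,1) → X` pushing the Lebesgue measure forward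
to the measure of `X`. -/
def IsParameter (X : MMSpace.{u}) (φ : Ico (0 : ℝ) 1 → X.carrier) : Prop :=
  Measurable φ ∧ Measure.map φ lebesgueIco = X.μ

/-- The condition on `ε` in the definition of the box distance: there are parameters `φ`, `ψ`
and a Borel set `I₀ ⊆ [0,1)` of Lebesgue measure at least `1 - ε` on which the two pulled back
distance functions differ by at most `ε`. -/
def BoxClose (X : MMSpace.{u}) (Y : MMSpace.{v}) (ε : ℝ≥0) : Prop :=
  ∃ (φ : Ico (0 : ℝ) 1 → X.carrier) (ψ : Ico (0 : ℝ) 1 → Y.carrier) (I₀ : Set (Ico (0 : ℝ) 1)),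
    IsParameter X φ ∧ IsParameter Y ψ ∧ MeasurableSet I₀ ∧
    (∀ s ∈ I₀, ∀ t ∈ I₀, |dist (φ s) (φ t) - dist (ψ s) (ψ t)| ≤ ε) ∧
    ENNReal.ofReal (1 - ε) ≤ lebesgueIco I₀

/-- The box distance between two mm-spaces (as an extended nonnegative number). -/
def boxDist (X : MMSpace.{u}) (Y : MMSpace.{v}) : ℝ≥0∞ :=
  ⨅ (ε : ℝ≥0) (_ : BoxClose X Y ε), (ε : ℝ≥0∞)

/-- The sequence `X` of mm-spaces, indexed by `n = 1, 2, …`, has a subsequence which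
converges to some mm-space with respect to the box distance. -/
def HasBoxConvergentSubseq (X : ℕ+ → MMSpace.{u}) : Prop :=
  ∃ (k : ℕ → ℕ+) (Y : MMSpace.{u}),
    StrictMono k ∧ Tendsto (fun i => boxDist (X (k i)) Y) atTop (𝓝 0)

/-! ### The intrinsic (Riemannian) distance -/

section Intrinsic

variable {X : Type*} [MetricSpace X]

/-- The infimum of the lengths of the curves in `X` from `x` to `y`. -/
def intrinsicEDist (x y : X) : ℝ≥0∞ :=
  ⨅ γ : Path x y, eVariationOn γ univ

lemma intrinsicEDist_self (x : X) : intrinsicEDist x x = 0 := by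
  refine le_antisymm (iInf_le_of_le (Path.refl x) (le_of_eq ?_)) bot_le
  apply eVariationOn.constant_on
  rintro _ ⟨s, _, rfl⟩ _ ⟨t, _, rfl⟩
  rfl

lemma edist_le_intrinsicEDist (x y : X) : edist x y ≤ intrinsicEDist x y := by
  refine le_iInf fun γ => ?_
  have h := eVariationOn.edist_le γ (mem_univ (0 : unitInterval)) (mem_univ 1)
  simpa using h

lemma intrinsicEDist_comm_le (x y : X) : intrinsicEDist x y ≤ intrinsicEDist y x := by
  refine le_iInf fun γ => iInf_le_of_le γ.symm ?_
  have h : (γ.symm : unitInterval → X) = γ ∘ unitInterval.symm := rfl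
  rw [h]
  refine eVariationOn.comp_le_of_antitoneOn _ _ ?_ (mapsTo_univ _ _)
  intro s _ t _ hst
  exact unitInterval.symm_le_symm.2 hst

lemma intrinsicEDist_comm (x y : X) : intrinsicEDist x y = intrinsicEDist y x :=
  le_antisymm (intrinsicEDist_comm_le x y) (intrinsicEDist_comm_le y x)

lemma intrinsicEDist_triangle (x y z : X) :
    intrinsicEDist x z ≤ intrinsicEDist x y + intrinsicEDist y z := by
  rw [intrinsicEDist, intrinsicEDist, intrinsicEDist]
  refine ENNReal.le_iInf_add_iInf fun γ γ' => iInf_le_of_le (γ.trans γ') ?_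
  let h : unitInterval := ⟨1 / 2, by norm_num, by norm_num⟩
  have hu : (univ : Set unitInterval) = Iic h ∪ Ici h := by
    ext t; simp
  rw [hu, eVariationOn.union (γ.trans γ') (s := Iic h) (t := Ici h) (x := h)
    ⟨mem_Iic.2 le_rfl, fun _ ht => ht⟩ ⟨mem_Ici.2 le_rfl, fun _ ht => ht⟩, ← hu]
  refine add_le_add ?_ ?_
  · have e : EqOn (γ.trans γ') (γ ∘ fun t : unitInterval => projIcc (0 : ℝ) 1 zero_le_one (2 * t))
        (Iic h) := by
      intro t ht
      have ht' : (t : ℝ) ≤ 1 / 2 := ht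
      have := Path.extend_trans_of_le_half γ γ' ht'
      simpa [Path.extend, IccExtend] using this
    rw [eVariationOn.congr e]
    refine eVariationOn.comp_le_of_monotoneOn _ _ ?_ (mapsTo_univ _ _)
    intro s _ t _ hst
    have : (s : ℝ) ≤ t := hst
    exact monotone_projIcc _ (by linarith)
  · have e : EqOn (γ.trans γ')
        (γ' ∘ fun t : unitInterval => projIcc (0 : ℝ) 1 zero_le_one (2 * t - 1)) (Ici h) := by
      intro t ht
      have ht' : 1 / 2 ≤ (t : ℝ) := ht
      have := Path.extend_trans_of_half_le γ γ' ht'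
      simpa [Path.extend, IccExtend] using this
    rw [eVariationOn.congr e]
    refine eVariationOn.comp_le_of_monotoneOn _ _ ?_ (mapsTo_univ _ _)
    intro s _ t _ hst
    have : (s : ℝ) ≤ t := hst
    exact monotone_projIcc _ (by linarith)

lemma intrinsicEDist_map {f : X → X} (hf : Isometry f) (x y : X) :
    intrinsicEDist (f x) (f y) ≤ intrinsicEDist x y := by
  refine le_iInf fun γ => iInf_le_of_le (γ.map hf.continuous) ?_
  simp only [eVariationOn, Path.map_coe, Function.comp_apply, hf.edist_eq]
  exact le_rfl

/-- The intrinsic metric, as a metric inducing the given topology, when it is bounded by a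
multiple of the given metric. -/
@[reducible] def intrinsicMetric (C : ℝ≥0)
    (hC : ∀ x y : X, intrinsicEDist x y ≤ C * edist x y) : MetricSpace X :=
  have hfin : ∀ x y : X, intrinsicEDist x y ≠ ∞ := fun x y =>
    ((hC x y).trans_lt (ENNReal.mul_lt_top ENNReal.coe_lt_top (edist_lt_top x y))).ne
  have hle : ∀ x y : X, dist x y ≤ (intrinsicEDist x y).toReal := fun x y => by
    rw [dist_edist]
    exact ENNReal.toReal_mono (hfin x y) (edist_le_intrinsicEDist x y)
  MetricSpace.ofDistTopology (fun x y => (intrinsicEDist x y).toReal)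
    (fun x => by simp [intrinsicEDist_self])
    (fun x y => by rw [intrinsicEDist_comm])
    (fun x y z => by
      rw [← ENNReal.toReal_add (hfin _ _) (hfin _ _)]
      exact ENNReal.toReal_mono (ENNReal.add_ne_top.2 ⟨hfin _ _, hfin _ _⟩)
        (intrinsicEDist_triangle x y z))
    (fun s => by
      rw [Metric.isOpen_iff]
      refine forall₂_congr fun x _ => ⟨?_, ?_⟩
      · rintro ⟨ε, hε, h⟩
        refine ⟨ε, hε, fun y hy => h ?_⟩
        rw [Metric.mem_ball, dist_comm]
        exact (hle x y).trans_lt hy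
      · rintro ⟨ε, hε, h⟩
        refine ⟨ε / (C + 1), by positivity, fun y hy => h y ?_⟩
        rw [Metric.mem_ball, dist_comm, lt_div_iff₀ (by positivity)] at hy
        have h1 := ENNReal.toReal_mono
          (ENNReal.mul_ne_top ENNReal.coe_ne_top (edist_ne_top x y)) (hC x y)
        rw [ENNReal.toReal_mul, ENNReal.coe_toReal, ← dist_edist] at h1
        nlinarith [dist_nonneg (x := x) (y := y)])
    (fun x y h => dist_le_zero.1 ((hle x y).trans h.le))

end Intrinsic

/-! ### Spheres -/

section Sphere

variable (E : Type*) [NormedAddCommGroup E] [InnerProductSpace ℝ E]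

/-- The sphere of radius `r` in `E` centered at the origin. -/
abbrev Sph (r : ℝ) : Type _ := Metric.sphere (0 : E) r

variable {E}

lemma exists_great_circle (hE : 2 ≤ Module.finrank ℝ E) {r : ℝ} (hr : 0 < r) (x y : Sph E r) :
    ∃ (w : E) (θ : ℝ), ‖w‖ = r ∧ inner ℝ (x : E) w = 0 ∧ 0 ≤ θ ∧ θ ≤ Real.pi ∧
      (y : E) = Real.cos θ • (x : E) + Real.sin θ • w := by
  have hx : ‖(x : E)‖ = r := by simp
  have hy : ‖(y : E)‖ = r := by simp
  set θ := InnerProductGeometry.angle (x : E) y with hθ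
  have h0 : 0 ≤ θ := InnerProductGeometry.angle_nonneg _ _
  have hpi : θ ≤ Real.pi := InnerProductGeometry.angle_le_pi _ _
  have hcos : Real.cos θ * (r * r) = inner ℝ (x : E) y := by
    have := InnerProductGeometry.cos_angle_mul_norm_mul_norm (x : E) (y : E)
    rwa [hx, hy] at this
  have hxx : inner ℝ (x : E) (x : E) = r * r := by rw [real_inner_self_eq_norm_mul_norm, hx]
  have hyy : inner ℝ (y : E) (y : E) = r * r := by rw [real_inner_self_eq_norm_mul_norm, hy]
  have hyx : inner ℝ (y : E) (x : E) = Real.cos θ * (r * r) := by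
    rw [real_inner_comm, hcos]
  have hn : ‖(y : E) - Real.cos θ • (x : E)‖ * ‖(y : E) - Real.cos θ • (x : E)‖
      = (Real.sin θ * r) * (Real.sin θ * r) := by
    rw [← real_inner_self_eq_norm_mul_norm]
    simp only [inner_sub_left, inner_sub_right, real_inner_smul_left, real_inner_smul_right,
      hxx, hyy, hyx, ← hcos]
    have := Real.sin_sq_add_cos_sq θ
    linear_combination (-r * r) * this
  have hs : 0 ≤ Real.sin θ := Real.sin_nonneg_of_nonneg_of_le_pi h0 hpi
  have hn' : ‖(y : E) - Real.cos θ • (x : E)‖ = Real.sin θ * r :=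
    (mul_self_inj (norm_nonneg _) (by positivity)).1 hn
  rcases hs.eq_or_lt with h | h
  · have hpos : (0 : E) ≠ x := by
      intro h0
      rw [← h0, norm_zero] at hx
      exact hr.ne hx
    obtain ⟨w, hw, hw0⟩ : ∃ w ∈ (Submodule.span ℝ {(x : E)})ᗮ, w ≠ 0 := by
      apply Submodule.exists_mem_ne_zero_of_ne_bot
      intro hb
      have : FiniteDimensional ℝ E := Module.finite_of_finrank_pos (by omega)
      have h1 := Submodule.finrank_add_finrank_orthogonal (Submodule.span ℝ {(x : E)})
      rw [hb, finrank_bot, finrank_span_singleton hpos.symm] at h1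
      omega
    have hw' : inner ℝ (x : E) w = 0 := Submodule.mem_orthogonal_singleton_iff_inner_right.1 hw
    have hnw : ‖w‖ ≠ 0 := norm_ne_zero_iff.2 hw0
    refine ⟨(r / ‖w‖) • w, θ, ?_, ?_, h0, hpi, ?_⟩
    · rw [norm_smul, Real.norm_of_nonneg (by positivity)]
      field_simp
    · rw [real_inner_smul_right, hw', mul_zero]
    · rw [← h, zero_mul, norm_eq_zero, sub_eq_zero] at hn'
      rw [← h, zero_smul, add_zero]
      exact hn'
  · refine ⟨(Real.sin θ)⁻¹ • ((y : E) - Real.cos θ • (x : E)), θ, ?_, ?_, h0, hpi, ?_⟩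
    · rw [norm_smul, hn', Real.norm_of_nonneg (by positivity)]
      field_simp
    · rw [real_inner_smul_right, inner_sub_right, real_inner_smul_right, hxx, hcos]
      simp
    · rw [smul_smul, mul_inv_cancel₀ h.ne', one_smul]
      abel

lemma norm_great_circle_sub {r : ℝ} {x w : E} (hx : ‖x‖ = r) (hw : ‖w‖ = r)
    (hxw : inner ℝ x w = 0) (s t : ℝ) :
    ‖(Real.cos s • x + Real.sin s • w) - (Real.cos t • x + Real.sin t • w)‖ ^ 2
      = r ^ 2 * (2 - 2 * Real.cos (s - t)) := by
  have hxx : inner ℝ x x = r ^ 2 := by rw [real_inner_self_eq_norm_sq, hx]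
  have hww : inner ℝ w w = r ^ 2 := by rw [real_inner_self_eq_norm_sq, hw]
  have hwx : inner ℝ w x = 0 := by rw [real_inner_comm, hxw]
  rw [← real_inner_self_eq_norm_sq, Real.cos_sub]
  simp only [inner_sub_left, inner_sub_right, inner_add_left, inner_add_right,
    real_inner_smul_left, real_inner_smul_right, hxx, hww, hxw, hwx]
  have h1 := Real.sin_sq_add_cos_sq s
  have h2 := Real.sin_sq_add_cos_sq t
  linear_combination r ^ 2 * h1 + r ^ 2 * h2

lemma norm_great_circle {r : ℝ} (hr : 0 < r) {x w : E} (hx : ‖x‖ = r) (hw : ‖w‖ = r)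
    (hxw : inner ℝ x w = 0) (t : ℝ) : ‖Real.cos t • x + Real.sin t • w‖ = r := by
  have hxx : inner ℝ x x = r ^ 2 := by rw [real_inner_self_eq_norm_sq, hx]
  have hww : inner ℝ w w = r ^ 2 := by rw [real_inner_self_eq_norm_sq, hw]
  have hwx : inner ℝ w x = 0 := by rw [real_inner_comm, hxw]
  have h : ‖Real.cos t • x + Real.sin t • w‖ ^ 2 = r ^ 2 := by
    rw [← real_inner_self_eq_norm_sq]
    simp only [inner_add_left, inner_add_right,
      real_inner_smul_left, real_inner_smul_right, hxx, hww, hxw, hwx]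
    linear_combination r ^ 2 * Real.sin_sq_add_cos_sq t
  exact (pow_left_inj₀ (norm_nonneg _) hr.le two_ne_zero).1 h

/-- On a sphere of dimension at least one, the intrinsic distance is at most `π / 2` times the
Euclidean distance. -/
lemma sphere_intrinsicEDist_le (hE : 2 ≤ Module.finrank ℝ E) {r : ℝ} (hr : 0 < r)
    (x y : Sph E r) :
    intrinsicEDist x y ≤ (Real.toNNReal (Real.pi / 2)) * edist x y := by
  obtain ⟨w, θ, hw, hxw, h0, hpi, hy⟩ := exists_great_circle hE hr x y
  have hx : ‖(x : E)‖ = r := by simp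
  let c : ℝ → Sph E r := fun t =>
    ⟨Real.cos t • (x : E) + Real.sin t • w, by
      simpa using norm_great_circle hr hx hw hxw t⟩
  have hc : LipschitzWith (Real.toNNReal r) c := by
    refine LipschitzWith.of_dist_le_mul fun s t => ?_
    rw [Subtype.dist_eq, dist_eq_norm, Real.dist_eq, Real.coe_toNNReal r hr.le]
    refine abs_le_of_sq_le_sq' ?_ (by positivity) |>.2
    rw [norm_great_circle_sub hx hw hxw, mul_pow, sq_abs]
    have := Real.one_sub_sq_div_two_le_cos (x := s - t)
    have hr2 : 0 ≤ r ^ 2 := by positivity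
    nlinarith
  let γ : Path x y :=
    { toFun := fun t => c (θ * t)
      continuous_toFun := hc.continuous.comp (by fun_prop)
      source' := by ext; simp [c]
      target' := by ext; simp [c, hy] }
  refine iInf_le_of_le γ ?_
  have h1 : eVariationOn γ univ ≤ (Real.toNNReal r : ℝ≥0∞) *
      eVariationOn (fun t : unitInterval => θ * (t : ℝ)) univ :=
    (hc.lipschitzOnWith (s := univ)).comp_eVariationOn_le (mapsTo_univ _ _)
  have h2 : eVariationOn (fun t : unitInterval => θ * (t : ℝ)) univ ≤ ENNReal.ofReal θ := by
    have hm : MonotoneOn (fun t : unitInterval => θ * (t : ℝ)) univ := by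
      intro s _ t _ hst
      exact mul_le_mul_of_nonneg_left hst h0
    have := hm.eVariationOn_eq (mem_univ (0 : unitInterval)) (mem_univ 1)
    have hI : (univ ∩ Icc 0 1 : Set unitInterval) = univ := by
      ext t; simp [unitInterval.le_one']
    rw [hI] at this
    simpa using this.le
  refine h1.trans ((mul_le_mul_right h2 _).trans ?_)
  rw [edist_dist, ← ENNReal.ofReal, ← ENNReal.ofReal, ← ENNReal.ofReal_mul hr.le,
    ← ENNReal.ofReal_mul (by positivity)]
  apply ENNReal.ofReal_le_ofReal
  have hd : dist x y = ‖(x : E) - y‖ := by rw [Subtype.dist_eq, dist_eq_norm]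
  have hd2 : dist x y ^ 2 = r ^ 2 * (2 - 2 * Real.cos θ) := by
    have := norm_great_circle_sub hx hw hxw 0 θ
    rw [hd, hy]
    simpa using this
  refine abs_le_of_sq_le_sq' ?_ (by positivity) |>.2
  rw [mul_pow, mul_pow, hd2]
  have hq := Real.cos_le_one_sub_mul_cos_sq (x := θ) (by rwa [abs_of_nonneg h0])
  have hr2 : 0 ≤ r ^ 2 := by positivity
  have h3 : θ ^ 2 ≤ (Real.pi / 2) ^ 2 * (2 - 2 * Real.cos θ) := by
    have h4 : (Real.pi / 2) ^ 2 * (2 * (2 / Real.pi ^ 2 * θ ^ 2)) = θ ^ 2 := by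
      have := Real.pi_ne_zero
      field_simp
      try norm_num
    rw [← h4]
    refine mul_le_mul_of_nonneg_left ?_ (by positivity)
    linarith
  nlinarith

/-- The Riemannian distance on a sphere of dimension at least one. -/
@[reducible] def riemannianMetric (hE : 2 ≤ Module.finrank ℝ E) {r : ℝ} (hr : 0 < r) :
    MetricSpace (Sph E r) :=
  intrinsicMetric (Real.toNNReal (Real.pi / 2)) (sphere_intrinsicEDist_le hE hr)

/-- The homothety from the unit sphere to the sphere of radius `r`. -/
def scaleSphere {r : ℝ} (hr : 0 < r) (u : Sph E 1) : Sph E r :=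
  ⟨r • (u : E), by
    have hu : ‖(u : E)‖ = 1 := by simp
    simp [norm_smul, hu, abs_of_pos hr]⟩

lemma continuous_scaleSphere {r : ℝ} (hr : 0 < r) : Continuous (scaleSphere (E := E) hr) := by
  unfold scaleSphere
  fun_prop

variable [MeasurableSpace E] [BorelSpace E] [FiniteDimensional ℝ E]

/-- The normalized volume measure on the sphere of radius `r`: the image under the homothety
`u ↦ r u` of the normalized surface measure on the unit sphere. -/
def sphereMeasure {r : ℝ} (hr : 0 < r) : Measure (Sph E r) :=
  Measure.map (scaleSphere hr)
    (((volume : Measure E).toSphere univ)⁻¹ • (volume : Measure E).toSphere)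

lemma isProbabilityMeasure_sphereMeasure (hE : 2 ≤ Module.finrank ℝ E) {r : ℝ} (hr : 0 < r) :
    IsProbabilityMeasure (sphereMeasure (E := E) hr) := by
  have : Nontrivial E := Module.nontrivial_of_finrank_pos (R := ℝ) (by omega)
  have h : (volume : Measure E).toSphere ≠ 0 := Measure.toSphere_ne_zero _
  have : NeZero (volume : Measure E).toSphere := ⟨h⟩
  have : IsProbabilityMeasure
      (((volume : Measure E).toSphere univ)⁻¹ • (volume : Measure E).toSphere) :=
    isProbabilityMeasureSMul
  exact Measure.isProbabilityMeasure_map (continuous_scaleSphere hr).measurable.aemeasurable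

/-- The sphere of radius `r` in `E` with the Euclidean distance. -/
def euclideanSphere {E : Type u} [NormedAddCommGroup E] [InnerProductSpace ℝ E]
    [MeasurableSpace E] [BorelSpace E] [FiniteDimensional ℝ E]
    (hE : 2 ≤ Module.finrank ℝ E) {r : ℝ} (hr : 0 < r) : MMSpace.{u} where
  carrier := Sph E r
  metric := inferInstance
  complete := complete_of_compact
  measurable := inferInstance
  borel := inferInstance
  μ := sphereMeasure hr
  prob := isProbabilityMeasure_sphereMeasure hE hr

/-- The sphere of radius `r` in `E` with the Riemannian distance. -/
def riemannianSphere {E : Type u} [NormedAddCommGroup E] [InnerProductSpace ℝ E]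
    [MeasurableSpace E] [BorelSpace E] [FiniteDimensional ℝ E]
    (hE : 2 ≤ Module.finrank ℝ E) {r : ℝ} (hr : 0 < r) : MMSpace.{u} where
  carrier := Sph E r
  metric := riemannianMetric hE hr
  complete := @complete_of_compact _ (riemannianMetric hE hr).toUniformSpace
    (inferInstanceAs (CompactSpace (Sph E r)))
  separable := inferInstanceAs (TopologicalSpace.SeparableSpace (Sph E r))
  measurable := inferInstance
  borel := inferInstanceAs (BorelSpace (Sph E r))
  μ := sphereMeasure hr
  prob := isProbabilityMeasure_sphereMeasure hE hr

end Sphere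

/-! ### Quotients by isometric group actions -/

section Quotient

/-- The orbit space of an action of `G` on `X`. -/
def OrbitSpace (X : Type*) (G : Type*) [Group G] [MulAction G X] : Type _ :=
  MulAction.orbitRel.Quotient G X

/-- The natural projection to the orbit space. -/
def orbitMk {X : Type*} (G : Type*) [Group G] [MulAction G X] (x : X) : OrbitSpace X G :=
  Quotient.mk (MulAction.orbitRel G X) x

lemma orbitMk_surjective {X : Type*} {G : Type*} [Group G] [MulAction G X] :
    Function.Surjective (orbitMk G : X → OrbitSpace X G) :=
  Quotient.mk_surjective

lemma orbitMk_eq {X : Type*} {G : Type*} [Group G] [MulAction G X] {x y : X} : orbitMk G x = orbitMk G y ↔ x ∈ MulAction.orbit G y :=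
  Quotient.eq (r := MulAction.orbitRel G X)

variable {X : Type*} [MetricSpace X] {G : Type*} [Group G] [MulAction G X]

/-- The distance between two orbits: the infimum of the distances between their points. -/
def orbitDist (a b : OrbitSpace X G) : ℝ :=
  sInf {d : ℝ | ∃ x y : X, orbitMk G x = a ∧ orbitMk G y = b ∧ d = dist x y}

lemma orbitDist_le (x y : X) : orbitDist (orbitMk G x) (orbitMk G y) ≤ dist x y :=
  csInf_le ⟨0, by rintro _ ⟨_, _, _, _, rfl⟩; exact dist_nonneg⟩ ⟨x, y, rfl, rfl, rfl⟩

lemma exists_dist_lt (h : ∀ (g : G) (x y : X), dist (g • x) (g • y) = dist x y)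
    (x : X) (b : OrbitSpace X G) {d : ℝ} (hd : orbitDist (orbitMk G x) b < d) :
    ∃ y, orbitMk G y = b ∧ dist x y < d := by
  obtain ⟨y₀, rfl⟩ := orbitMk_surjective b
  obtain ⟨_, ⟨x', y', hx, hy, rfl⟩, hlt⟩ :=
    exists_lt_of_csInf_lt (s := {d : ℝ | ∃ x' y' : X,
      orbitMk G x' = orbitMk G x ∧ orbitMk G y' = orbitMk G y₀ ∧ d = dist x' y'})
      ⟨_, x, y₀, rfl, rfl, rfl⟩ hd
  obtain ⟨g, rfl⟩ := orbitMk_eq.1 hx.symm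
  refine ⟨g • y', ?_, by rwa [h]⟩
  rw [← hy]
  exact orbitMk_eq.2 ⟨g, rfl⟩

lemma orbitDist_nonneg (a b : OrbitSpace X G) : 0 ≤ orbitDist a b :=
  Real.sInf_nonneg (by rintro _ ⟨_, _, _, _, rfl⟩; exact dist_nonneg)

/-- The metric on the orbit space of an isometric action with closed orbits. -/
@[reducible] def orbitMetric (h : ∀ (g : G) (x y : X), dist (g • x) (g • y) = dist x y)
    (hcl : ∀ x : X, IsClosed (MulAction.orbit G x)) : MetricSpace (OrbitSpace X G) where
  dist := orbitDist
  dist_self a := by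
    obtain ⟨x, rfl⟩ := orbitMk_surjective a
    exact le_antisymm ((orbitDist_le x x).trans (dist_self x).le) (orbitDist_nonneg _ _)
  dist_comm a b := by
    unfold orbitDist
    congr 1
    ext d
    constructor
    · rintro ⟨x, y, hx, hy, rfl⟩
      exact ⟨y, x, hy, hx, dist_comm x y⟩
    · rintro ⟨x, y, hx, hy, rfl⟩
      exact ⟨y, x, hy, hx, dist_comm x y⟩
  dist_triangle a b c := by
    obtain ⟨x, rfl⟩ := orbitMk_surjective a
    refine le_of_forall_pos_le_add fun ε hε => ?_
    obtain ⟨y, rfl, hy⟩ := exists_dist_lt h x b (lt_add_of_pos_right _ (half_pos hε))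
    obtain ⟨z, rfl, hz⟩ := exists_dist_lt h y c (lt_add_of_pos_right _ (half_pos hε))
    have := orbitDist_le (G := G) x z
    have := dist_triangle x y z
    linarith
  eq_of_dist_eq_zero {a b} hab := by
    obtain ⟨x, rfl⟩ := orbitMk_surjective a
    obtain ⟨y, rfl⟩ := orbitMk_surjective b
    rw [orbitMk_eq, ← (hcl y).closure_eq, Metric.mem_closure_iff]
    intro ε hε
    obtain ⟨z, hz, hxz⟩ := exists_dist_lt h x (orbitMk G y) (d := ε) (by
      have : orbitDist (orbitMk G x) (orbitMk G y) = 0 := hab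
      rwa [this])
    exact ⟨z, orbitMk_eq.1 hz, hxz⟩

lemma continuous_orbitMk (h : ∀ (g : G) (x y : X), dist (g • x) (g • y) = dist x y)
    (hcl : ∀ x : X, IsClosed (MulAction.orbit G x)) :
    let _ := orbitMetric h hcl
    Continuous (orbitMk G : X → OrbitSpace X G) := by
  let _ := orbitMetric h hcl
  exact (LipschitzWith.of_dist_le_mul (K := 1) fun x y => by
    rw [NNReal.coe_one, one_mul]
    exact orbitDist_le (G := G) x y).continuous

/-- The quotient of a compact mm-space by an isometric group action with closed orbits,
with the induced metric and the induced measure (the push-forward by the projection). -/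
def MMSpace.quotient (X : MMSpace.{u}) [CompactSpace X.carrier] (G : Type) [Group G]
    [MulAction G X.carrier]
    (h : ∀ (g : G) (x y : X.carrier), dist (g • x) (g • y) = dist x y)
    (hcl : ∀ x : X.carrier, IsClosed (MulAction.orbit G x)) : MMSpace.{u} :=
  letI : MetricSpace (OrbitSpace X.carrier G) := orbitMetric h hcl
  have : CompactSpace (OrbitSpace X.carrier G) := by
    constructor
    rw [← orbitMk_surjective.range_eq]
    exact isCompact_range (continuous_orbitMk h hcl)
  letI : MeasurableSpace (OrbitSpace X.carrier G) := _root_.borel _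
  haveI : BorelSpace (OrbitSpace X.carrier G) := ⟨rfl⟩
  { carrier := OrbitSpace X.carrier G
    μ := Measure.map (orbitMk G) X.μ
    complete := complete_of_compact
    separable := inferInstance
    prob := Measure.isProbabilityMeasure_map
      (continuous_orbitMk h hcl).measurable.aemeasurable }

end Quotient

/-! ### Spheres `S^n(r)` and complex projective spaces `ℂP^n(r)` -/

lemma two_le_finrank_real (n : ℕ+) :
    2 ≤ Module.finrank ℝ (EuclideanSpace ℝ (Fin (n + 1))) := by
  have := n.pos
  simp
  omega

lemma two_le_finrank_complex (n : ℕ+) :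
    2 ≤ Module.finrank ℝ (EuclideanSpace ℂ (Fin (n + 1))) := by
  rw [finrank_real_of_complex, finrank_euclideanSpace_fin]
  omega

/-- `S^n(r) ⊆ ℝ^(n+1)` with the restriction of the Euclidean distance. -/
def sphereEuc (n : ℕ+) (r : ℝ) (hr : 0 < r) : MMSpace.{0} :=
  euclideanSphere (two_le_finrank_real n) hr

/-- `S^n(r) ⊆ ℝ^(n+1)` with the Riemannian distance. -/
def sphereRiem (n : ℕ+) (r : ℝ) (hr : 0 < r) : MMSpace.{0} :=
  riemannianSphere (two_le_finrank_real n) hr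

/-- The Hopf action of the unit complex numbers on the sphere of radius `r` in `ℂ^m`
(by scalar multiplication). -/
instance hopfAction (m : ℕ) (r : ℝ) : MulAction Circle (Sph (EuclideanSpace ℂ (Fin m)) r) :=
  inferInstanceAs (MulAction (Metric.sphere (0 : ℂ) 1) (Sph (EuclideanSpace ℂ (Fin m)) r))

lemma coe_hopf_smul {m : ℕ} {r : ℝ} (z : Circle) (x : Sph (EuclideanSpace ℂ (Fin m)) r) :
    ((z • x : Sph (EuclideanSpace ℂ (Fin m)) r) : EuclideanSpace ℂ (Fin m))
      = (z : ℂ) • (x : EuclideanSpace ℂ (Fin m)) := rfl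

lemma isometry_hopf {m : ℕ} {r : ℝ} (z : Circle) :
    Isometry fun x : Sph (EuclideanSpace ℂ (Fin m)) r => z • x := by
  refine Isometry.of_dist_eq fun x y => ?_
  rw [Subtype.dist_eq, Subtype.dist_eq, coe_hopf_smul, coe_hopf_smul, dist_smul₀,
    Circle.norm_coe, one_mul]

lemma le_intrinsicEDist_hopf {m : ℕ} {r : ℝ} (z : Circle)
    (x y : Sph (EuclideanSpace ℂ (Fin m)) r) :
    intrinsicEDist x y ≤ intrinsicEDist (z • x) (z • y) := by
  have h := intrinsicEDist_map (isometry_hopf z⁻¹) (z • x) (z • y)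
  rwa [inv_smul_smul, inv_smul_smul] at h

lemma isClosed_hopf_orbit {m : ℕ} {r : ℝ} (x : Sph (EuclideanSpace ℂ (Fin m)) r) :
    IsClosed (MulAction.orbit Circle x) := by
  refine (isCompact_range (f := fun z : Circle => z • x) ?_).isClosed
  refine Continuous.subtype_mk (f := fun z : Circle => (z : ℂ) • (x : EuclideanSpace ℂ (Fin m)))
    ?_ _
  fun_prop

/-- The sphere `S^(2n+1)(r) ⊆ ℂ^(n+1)` with the Euclidean distance. -/
abbrev oddSphereEuc (n : ℕ+) (r : ℝ) (hr : 0 < r) : MMSpace.{0} :=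
  euclideanSphere (two_le_finrank_complex n) hr

/-- The sphere `S^(2n+1)(r) ⊆ ℂ^(n+1)` with the Riemannian distance. -/
abbrev oddSphereRiem (n : ℕ+) (r : ℝ) (hr : 0 < r) : MMSpace.{0} :=
  riemannianSphere (two_le_finrank_complex n) hr

/-- `ℂP^n(r) = S^(2n+1)(r) / S^1` with the distance induced from the Euclidean distance. -/
def projEuc (n : ℕ+) (r : ℝ) (hr : 0 < r) : MMSpace.{0} :=
  haveI : CompactSpace (oddSphereEuc n r hr).carrier :=
    inferInstanceAs (CompactSpace (Sph (EuclideanSpace ℂ (Fin (n + 1))) r))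
  letI : MulAction Circle (oddSphereEuc n r hr).carrier := hopfAction (n + 1) r
  (oddSphereEuc n r hr).quotient Circle
    (fun z x y => (isometry_hopf z).dist_eq x y) isClosed_hopf_orbit

/-- `ℂP^n(r) = S^(2n+1)(r) / S^1` with the distance induced from the Riemannian distance,
that is, with the Fubini-Study distance scaled by `r`. -/
def projRiem (n : ℕ+) (r : ℝ) (hr : 0 < r) : MMSpace.{0} :=
  haveI : CompactSpace (oddSphereRiem n r hr).carrier :=
    inferInstanceAs (CompactSpace (Sph (EuclideanSpace ℂ (Fin (n + 1))) r))
  letI : MulAction Circle (oddSphereRiem n r hr).carrier := hopfAction (n + 1) r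
  (oddSphereRiem n r hr).quotient Circle
    (fun z x y => congrArg ENNReal.toReal (le_antisymm
      (intrinsicEDist_map (isometry_hopf z) x y)
      (le_intrinsicEDist_hopf z x y)))
    isClosed_hopf_orbit

end MMGeom

end

namespace MMGeom

universe u v

/-! ### Small balls and convergence in the box distance -/

/-! A box limit `Y` is separable, so for any fixed radius finitely many balls, say `N`, carry most
of its mass. If `X` is box close to `Y`, a ball of `Y` pulled back by the parameter of `Y` and cut
down to `I₀` is carried by the parameter of `X` into one slightly larger ball. Hence `N` balls of
`X` carry at least half of its mass (`BoxClose.half_le`). Since `N` depends only on `Y` and the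
radius, convergence is impossible when all balls of a fixed radius have measure at most `1/n` in the
`n`-th space (`not_hasBoxConvergentSubseq`).

This bound needs no sharp concentration of measure. A point of the sphere of radius `r` within `r/4`
of the orbit of `x` under unit scalars of `𝕜` has more than half of its squared length along `x`.
Such cones around the vectors of an orthonormal basis are disjoint by Bessel and have equal measure
by isometry invariance, so each has measure at most `1/dim` (`sphereMeasure_directionCone_le`). `𝕜 =
ℝ` gives the spheres and `𝕜 = ℂ` the projective spaces; the lower bound on the radii makes `r/4`
uniform. The Riemannian distance dominates the Euclidean one, so its balls are smaller. -/

/-- A finite union of `δ`-balls has measure close to `1`. -/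
lemma exists_finite_balls_lt_measure (Y : MMSpace.{u}) {δ : ℝ} (hδ : 0 < δ) {m : ℝ≥0∞}
    (hm : m < 1) :
    ∃ (y : ℕ → Y.carrier) (N : ℕ), m < Y.μ (⋃ j ∈ Finset.range N, Metric.ball (y j) δ) := by
  have : Nonempty Y.carrier := nonempty_of_isProbabilityMeasure Y.μ
  let y := TopologicalSpace.denseSeq Y.carrier
  have hy : (⋃ j, Metric.ball (y j) δ) = univ := by
    refine eq_univ_of_forall fun z => ?_
    obtain ⟨j, hj⟩ := (TopologicalSpace.denseRange_denseSeq Y.carrier).exists_dist_lt z hδ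
    exact mem_iUnion.2 ⟨j, hj⟩
  have ht := tendsto_measure_iUnion_accumulate (μ := Y.μ) (f := fun j => Metric.ball (y j) δ)
  rw [hy, measure_univ] at ht
  obtain ⟨N, hN⟩ := (ht.eventually_const_lt hm).exists
  -- The accumulated union runs over `j ≤ N`, hence `N + 1` balls.
  refine ⟨y, N + 1, hN.trans_le (measure_mono ?_)⟩
  intro z hz
  simp only [accumulate_def, mem_iUnion] at hz
  obtain ⟨j, hj, hz⟩ := hz
  exact mem_biUnion (Finset.mem_coe.2 (Finset.mem_range.2 (Nat.lt_succ_of_le hj))) hz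

/-- A push-forward preserves total mass, so one parameter already forces mass `1`; no computation on
the interval is needed. -/
lemma IsParameter.measure_univ {X : MMSpace.{u}} {φ : Ico (0 : ℝ) 1 → X.carrier}
    (hφ : IsParameter X φ) : lebesgueIco univ = 1 := by
  have h : Measure.map φ lebesgueIco univ = X.μ univ := by rw [hφ.2]
  rwa [Measure.map_apply hφ.1 MeasurableSet.univ, preimage_univ,
    MeasureTheory.measure_univ (μ := X.μ)] at h

/-- If `X` is box close to `Y`, and finitely many balls in `Y` cover most of the measure,
then not all balls in `X` have small measure. -/
lemma BoxClose.half_le {X : MMSpace.{u}} {Y : MMSpace.{v}} {ε : ℝ≥0} (h : BoxClose X Y ε)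
    {ρ : ℝ} (hε : (ε : ℝ) ≤ ρ / 3) (hε' : (ε : ℝ) ≤ 1 / 4) {y : ℕ → Y.carrier} {N : ℕ}
    (hN : ENNReal.ofReal (3 / 4) < Y.μ (⋃ j ∈ Finset.range N, Metric.ball (y j) (ρ / 3)))
    {m : ℝ≥0∞} (hm : ∀ x, X.μ (Metric.closedBall x ρ) ≤ m) :
    ENNReal.ofReal (1 / 2) ≤ N * m := by
  obtain ⟨φ, ψ, I₀, hφ, hψ, hI, hd, hμ⟩ := h
  set B : Set Y.carrier := ⋃ j ∈ Finset.range N, Metric.ball (y j) (ρ / 3) with hB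
  have hBm : MeasurableSet B :=
    Finset.measurableSet_biUnion _ fun j _ => Metric.isOpen_ball.measurableSet
  rw [← hψ.2, Measure.map_apply hψ.1 hBm] at hN
  have hI' : ENNReal.ofReal (3 / 4) ≤ lebesgueIco I₀ :=
    (ENNReal.ofReal_le_ofReal (by linarith)).trans hμ
  have hpiece : ∀ j, lebesgueIco (I₀ ∩ ψ ⁻¹' Metric.ball (y j) (ρ / 3)) ≤ m := by
    intro j
    -- A nonempty piece supplies a point `s`, and `φ s` is the centre of the ball in `X` that
    -- receives it.
    rcases (I₀ ∩ ψ ⁻¹' Metric.ball (y j) (ρ / 3)).eq_empty_or_nonempty with he | ⟨s, hs, hsj⟩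
    · rw [he, measure_empty]
      exact zero_le
    · refine le_trans (measure_mono ?_) (Measure.map_apply hφ.1
        (Metric.isClosed_closedBall (x := φ s) (ε := ρ)).measurableSet ▸ hφ.2 ▸ hm (φ s))
      rintro t ⟨ht, htj⟩
      -- The radii add up to `ρ/3 + ρ/3` from the ball in `Y` and `ρ/3` from the distortion `ε`.
      have h1 := abs_le.1 (hd t ht s hs)
      have h2 := dist_triangle_right (ψ t) (ψ s) (y j)
      have h3 : dist (ψ t) (y j) < ρ / 3 := htj
      have h4 : dist (ψ s) (y j) < ρ / 3 := hsj
      show dist (φ t) (φ s) ≤ ρ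
      linarith [h1.2]
  -- Two sets of measure at least `3/4` in a space of mass `1` overlap in at least `3/4 + 3/4 - 1 =
  -- 1/2`.
  have hinter : ENNReal.ofReal (1 / 2) ≤ lebesgueIco (I₀ ∩ ψ ⁻¹' B) := by
    have h1 := measure_union_add_inter (μ := lebesgueIco) I₀ (hψ.1 hBm)
    have h2 : lebesgueIco (I₀ ∪ ψ ⁻¹' B) ≤ 1 :=
      hφ.measure_univ ▸ measure_mono (subset_univ _)
    have h3 : ENNReal.ofReal (3 / 4) + ENNReal.ofReal (3 / 4) ≤
        1 + lebesgueIco (I₀ ∩ ψ ⁻¹' B) :=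
      (add_le_add hI' hN.le).trans (h1 ▸ add_le_add_left h2 _)
    have h4 : ENNReal.ofReal (3 / 4) + ENNReal.ofReal (3 / 4) = 1 + ENNReal.ofReal (1 / 2) := by
      rw [← ENNReal.ofReal_one, ← ENNReal.ofReal_add, ← ENNReal.ofReal_add] <;> norm_num
    rw [h4] at h3
    exact (ENNReal.add_le_add_iff_left ENNReal.one_ne_top).1 h3
  calc ENNReal.ofReal (1 / 2) ≤ lebesgueIco (I₀ ∩ ψ ⁻¹' B) := hinter
    _ ≤ lebesgueIco (⋃ j ∈ Finset.range N, I₀ ∩ ψ ⁻¹' Metric.ball (y j) (ρ / 3)) := by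
        refine measure_mono ?_
        rw [hB, preimage_iUnion₂, inter_iUnion₂]
    _ ≤ ∑ j ∈ Finset.range N, lebesgueIco (I₀ ∩ ψ ⁻¹' Metric.ball (y j) (ρ / 3)) :=
        measure_biUnion_finset_le _ _
    _ ≤ ∑ _j ∈ Finset.range N, m := Finset.sum_le_sum fun j _ => hpiece j
    _ = N * m := by simp

/-- If the measures of all balls of some fixed radius tend uniformly to zero along the sequence,
then no subsequence is convergent in the box distance. -/
lemma not_hasBoxConvergentSubseq {X : ℕ+ → MMSpace.{u}} {ρ : ℝ} (hρ : 0 < ρ)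
    (hX : ∀ n x, (X n).μ (Metric.closedBall x ρ) ≤ (n : ℝ≥0∞)⁻¹) :
    ¬ HasBoxConvergentSubseq X := by
  rintro ⟨k, Y, hk, ht⟩
  obtain ⟨y, N, hN⟩ := exists_finite_balls_lt_measure Y (δ := ρ / 3) (by positivity)
    (m := ENNReal.ofReal (3 / 4)) (by rw [ENNReal.ofReal_lt_one]; norm_num)
  -- The minimum collects the two bounds on `ε` required by `BoxClose.half_le`.
  have hδ : (0 : ℝ≥0∞) < ENNReal.ofReal (min (ρ / 3) (1 / 4)) :=
    ENNReal.ofReal_pos.2 (by positivity)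
  have hbig : ∀ᶠ i in atTop, ENNReal.ofReal (1 / 2) ≤ N * ((k i : ℕ) : ℝ≥0∞)⁻¹ := by
    filter_upwards [ht.eventually_lt_const hδ] with i hi
    simp only [boxDist, iInf_lt_iff] at hi
    obtain ⟨ε, hε, hlt⟩ := hi
    have hε' : (ε : ℝ) < min (ρ / 3) (1 / 4) := by
      rw [← ENNReal.ofReal_coe_nnreal, ENNReal.ofReal_lt_ofReal_iff (by positivity)] at hlt
      exact hlt
    exact hε.half_le (hε'.le.trans (min_le_left _ _)) (hε'.le.trans (min_le_right _ _)) hN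
      (hX (k i))
  have hkt : Tendsto (fun i => (k i : ℕ)) atTop atTop :=
    StrictMono.tendsto_atTop fun i j hij => PNat.coe_lt_coe _ _ |>.2 (hk hij)
  have hlim : Tendsto (fun i => N * ((k i : ℕ) : ℝ≥0∞)⁻¹) atTop (𝓝 (N * 0)) :=
    ENNReal.Tendsto.const_mul (ENNReal.tendsto_inv_nat_nhds_zero.comp hkt)
      (Or.inr (ENNReal.natCast_ne_top N))
  -- `N` is fixed while the ball measures vanish, so the limit reads `1/2 ≤ 0`.
  have := ge_of_tendsto hlim hbig
  norm_num at this

/-- Balls in a quotient have small measure if tubes around orbits have small measure. -/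
lemma measure_closedBall_quotient_le (X : MMSpace.{u}) [CompactSpace X.carrier] (G : Type)
    [Group G] [MulAction G X.carrier]
    (h : ∀ (g : G) (x y : X.carrier), dist (g • x) (g • y) = dist x y)
    (hcl : ∀ x : X.carrier, IsClosed (MulAction.orbit G x)) {ρ ρ' : ℝ} (hρ : ρ < ρ') {m : ℝ≥0∞}
    (hm : ∀ x : X.carrier, X.μ {y | ∃ g : G, dist x (g • y) ≤ ρ'} ≤ m)
    (a : (X.quotient G h hcl).carrier) :
    (X.quotient G h hcl).μ (Metric.closedBall a ρ) ≤ m := by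
  let p : X.carrier → (X.quotient G h hcl).carrier := orbitMk G
  have hp : Continuous p := continuous_orbitMk h hcl
  have hμ : (X.quotient G h hcl).μ = Measure.map p X.μ := rfl
  rw [hμ, Measure.map_apply hp.measurable Metric.isClosed_closedBall.measurableSet]
  obtain ⟨x, rfl⟩ := orbitMk_surjective (G := G) a
  refine (measure_mono ?_).trans (hm x)
  intro y hy
  have hd : orbitDist (orbitMk G y) (orbitMk G x) ≤ ρ := hy
  -- The strict gap `ρ < ρ'` yields a representative within `ρ'` without the infimum having to be
  -- attained.
  have hd' : orbitDist (orbitMk G x) (orbitMk G y) < ρ' := by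
    exact ((dist_comm (p x) (p y)).trans_le hd).trans_lt hρ
  obtain ⟨z, hz, hxz⟩ := exists_dist_lt h x _ hd'
  obtain ⟨g, rfl⟩ := orbitMk_eq.1 hz
  exact ⟨g, hxz.le⟩

/-! ### Tubes in spheres -/

open scoped Pointwise

/-! ### Cones around a line in an inner product space -/

section DirectionCone

variable (𝕜 : Type*) {E : Type*} [RCLike 𝕜] [NormedAddCommGroup E] [InnerProductSpace 𝕜 E]

/-- The set of vectors more than half of whose squared length lies in the direction of the unit
vector `u`. -/
def directionCone (u : E) : Set E :=
  {y | ‖y‖ ^ 2 / 2 < ‖inner 𝕜 u y‖ ^ 2}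

lemma isOpen_directionCone (u : E) : IsOpen (directionCone 𝕜 u) :=
  isOpen_lt (by fun_prop) (by fun_prop)

-- Bessel's inequality for two basis vectors: a common point would have two squared coefficients,
-- each more than half of `‖y‖ ^ 2`.
variable {𝕜} in
lemma disjoint_directionCone {ι : Type*} {b : ι → E} (hb : Orthonormal 𝕜 b) {i j : ι}
    (hij : i ≠ j) : Disjoint (directionCone 𝕜 (b i)) (directionCone 𝕜 (b j)) := by
  classical
  rw [Set.disjoint_left]
  intro y hi hj
  have h := hb.sum_inner_products_le y (s := {i, j})
  rw [Finset.sum_pair hij] at h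
  have hi' : ‖y‖ ^ 2 / 2 < ‖inner 𝕜 (b i) y‖ ^ 2 := hi
  have hj' : ‖y‖ ^ 2 / 2 < ‖inner 𝕜 (b j) y‖ ^ 2 := hj
  linarith

/-- Replacing `z • y` by `x` changes the inner product with `x` by at most `r * (r / 4)`, so `|⟨x,
y⟩| ≥ 3r²/4`. The radius `r / 4` suffices because `(3/4)² = 9/16 > 1/2`. -/
lemma mem_directionCone_of_dist_le {r : ℝ} (hr : 0 < r) {x y : E} (hx : ‖x‖ = r) (hy : ‖y‖ = r)
    {z : 𝕜} (hz : ‖z‖ = 1) (h : dist x (z • y) ≤ r / 4) :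
    y ∈ directionCone 𝕜 (((r⁻¹ : ℝ) : 𝕜) • x) := by
  have h1 : inner 𝕜 x (z • y) = inner 𝕜 x x - inner 𝕜 x (x - z • y) := by
    rw [inner_sub_right]; ring
  have h2 : ‖inner 𝕜 x x‖ = r ^ 2 := by
    rw [inner_self_eq_norm_sq_to_K, hx, norm_pow, RCLike.norm_ofReal, abs_of_pos hr]
  have h3 : ‖inner 𝕜 x (x - z • y)‖ ≤ r * (r / 4) := by
    refine (norm_inner_le_norm _ _).trans ?_
    rw [hx, ← dist_eq_norm]
    exact mul_le_mul_of_nonneg_left h hr.le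
  have h4 : ‖inner 𝕜 x (z • y)‖ = ‖inner 𝕜 x y‖ := by
    rw [inner_smul_right, norm_mul, hz, one_mul]
  have h5 := norm_sub_norm_le (inner 𝕜 x x) (inner 𝕜 x (x - z • y))
  rw [← h1, h2, h4] at h5
  have h6 : r * (3 / 4) ≤ ‖inner 𝕜 (((r⁻¹ : ℝ) : 𝕜) • x) y‖ := by
    rw [inner_smul_left, norm_mul, RCLike.norm_conj, RCLike.norm_ofReal,
      abs_of_pos (inv_pos.2 hr), inv_mul_eq_div, le_div_iff₀ hr]
    nlinarith
  show ‖y‖ ^ 2 / 2 < _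
  rw [hy]
  nlinarith [mul_pos hr hr]

end DirectionCone

/-! ### Isometry invariance and the inverse-dimension bound -/

section Sphere

variable {E : Type*} [NormedAddCommGroup E] [InnerProductSpace ℝ E] [MeasurableSpace E]
  [BorelSpace E] [FiniteDimensional ℝ E]

/-- The normalized volume measure of a sphere is invariant under linear isometries. -/
lemma sphereMeasure_preimage {r : ℝ} (hr : 0 < r) (U : E ≃ₗᵢ[ℝ] E) {A : Set E}
    (hA : MeasurableSet A) :
    sphereMeasure (E := E) hr {y | U y ∈ A} = sphereMeasure hr {y : Sph E r | (y : E) ∈ A} := by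
  have hUA : MeasurableSet (U ⁻¹' A) := U.continuous.measurable hA
  -- The surface measure of a set is, up to a constant, the Lebesgue measure of the cone over it, so
  -- invariance reduces to `U` preserving volume on `E`.
  have key : ∀ {B : Set E}, MeasurableSet B → sphereMeasure hr {y : Sph E r | (y : E) ∈ B} =
      ((volume : Measure E).toSphere univ)⁻¹ * (Module.finrank ℝ E *
        volume (Ioo (0 : ℝ) 1 • (Subtype.val '' {u : Sph E 1 | r • (u : E) ∈ B}))) := by
    intro B hB
    have h1 : MeasurableSet {y : Sph E r | (y : E) ∈ B} := measurable_subtype_coe hB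
    rw [sphereMeasure, Measure.map_apply (continuous_scaleSphere hr).measurable h1,
      Measure.smul_apply, smul_eq_mul,
      Measure.toSphere_apply' _ ((continuous_scaleSphere hr).measurable h1)]
    rfl
  have h1 := key hUA
  rw [key hA]
  refine h1.trans ?_
  congr 2
  have hU : MeasurePreserving U.toHomeomorph.toMeasurableEquiv volume volume := U.measurePreserving
  symm
  rw [← hU.measure_preimage_equiv]
  congr 1
  -- The preimage under `U` of the cone over a set is the cone over the preimage; points on the unit
  -- sphere correspond by `U` and `U.symm`.
  ext z
  constructor
  · rintro ⟨t, ht, _, ⟨u, hu, rfl⟩, hz⟩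
    refine ⟨t, ht, U.symm u, ⟨⟨U.symm u, by simp⟩, by simpa using hu, rfl⟩, ?_⟩
    have hz' : t • (u : E) = U z := hz
    show t • U.symm (u : E) = z
    rw [← map_smul, hz', U.symm_apply_apply]
  · rintro ⟨t, ht, _, ⟨u, hu, rfl⟩, rfl⟩
    exact ⟨t, ht, U u, ⟨⟨U u, by simp⟩, by simpa using hu, rfl⟩, (map_smul U t (u : E)).symm⟩

variable (𝕜 : Type*) [RCLike 𝕜] [InnerProductSpace 𝕜 E]

/-- Completing `u` to an orthonormal basis gives `dim` disjoint cones of equal measure in a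
probability space. -/
lemma sphereMeasure_directionCone_le [LinearMap.CompatibleSMul E E ℝ 𝕜]
    [FiniteDimensional 𝕜 E] (hE : 2 ≤ Module.finrank ℝ E) {r : ℝ} (hr : 0 < r) {u : E}
    (hu : ‖u‖ = 1) :
    sphereMeasure hr {y : Sph E r | (y : E) ∈ directionCone 𝕜 u} ≤
      (Module.finrank 𝕜 E : ℝ≥0∞)⁻¹ := by
  have := isProbabilityMeasure_sphereMeasure hE hr
  have : Nontrivial E := Module.nontrivial_of_finrank_pos (R := ℝ) (by omega)
  have hpos : 0 < Module.finrank 𝕜 E := Module.finrank_pos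
  set N := Module.finrank 𝕜 E with hN
  let i₀ : Fin N := ⟨0, hpos⟩
  -- Only the value at `i₀` is prescribed, so orthonormality of the constant family is asked on a
  -- singleton.
  obtain ⟨b, hb⟩ := Orthonormal.exists_orthonormalBasis_extension_of_card_eq (𝕜 := 𝕜) (E := E)
    (ι := Fin N) (by simp [hN]) (v := fun _ => u) (s := {i₀})
    ⟨fun _ => hu, fun i j hij => (hij (Subsingleton.elim i j)).elim⟩
  have hb₀ : b i₀ = u := hb i₀ rfl
  let S : Fin N → Set (Sph E r) := fun i => {y | (y : E) ∈ directionCone 𝕜 (b i)}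
  have hS : ∀ i, MeasurableSet (S i) := fun i =>
    measurable_subtype_coe (isOpen_directionCone 𝕜 (b i)).measurableSet
  have heq : ∀ i, sphereMeasure hr (S i) = sphereMeasure hr (S i₀) := by
    intro i
    -- Swapping two basis vectors takes one cone to the other; `U` is then viewed as a real
    -- isometry, the kind under which invariance was proved.
    let U := b.equiv b (Equiv.swap i₀ i)
    let V : E ≃ₗᵢ[ℝ] E := ⟨U.toLinearEquiv.restrictScalars ℝ, U.norm_map⟩
    rw [← sphereMeasure_preimage hr V (isOpen_directionCone 𝕜 (b i)).measurableSet]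
    congr 1
    ext y
    have hV : V y = U y := rfl
    have hbi : b i = U (b i₀) := by simp [U]
    simp only [mem_ofPred_eq, directionCone, hV, S, hbi, U.inner_map_map, U.norm_map]
  have hsum : ∑ i, sphereMeasure hr (S i) ≤ 1 := by
    rw [← tsum_fintype (L := .unconditional _), ← measure_iUnion (fun i j hij => ?_) hS]
    · exact prob_le_one
    · exact (disjoint_directionCone b.orthonormal hij).preimage _
  simp only [heq, Finset.sum_const, Finset.card_univ, Fintype.card_fin, nsmul_eq_mul] at hsum
  have hS₀ : S i₀ = {y : Sph E r | (y : E) ∈ directionCone 𝕜 u} := by simp only [S, hb₀]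
  rw [hS₀] at hsum
  rwa [ENNReal.le_inv_iff_mul_le, mul_comm]

/-- The tube of radius `r / 4` around an orbit of the unit scalars in the sphere of radius `r`
has measure at most the inverse of the dimension. -/
lemma sphereMeasure_tube_le [LinearMap.CompatibleSMul E E ℝ 𝕜]
    [FiniteDimensional 𝕜 E] (hE : 2 ≤ Module.finrank ℝ E) {r : ℝ} (hr : 0 < r) (x : Sph E r) :
    sphereMeasure hr {y : Sph E r | ∃ z : 𝕜, ‖z‖ = 1 ∧ dist (x : E) (z • (y : E)) ≤ r / 4} ≤
      (Module.finrank 𝕜 E : ℝ≥0∞)⁻¹ := by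
  refine (measure_mono ?_).trans (sphereMeasure_directionCone_le 𝕜 hE hr
    (u := ((r⁻¹ : ℝ) : 𝕜) • (x : E)) ?_)
  · rintro y ⟨z, hz, hd⟩
    exact mem_directionCone_of_dist_le 𝕜 hr (by simp) (by simp) hz hd
  · rw [norm_smul, RCLike.norm_ofReal, abs_of_pos (inv_pos.2 hr), mem_sphere_zero_iff_norm.1 x.2,
      inv_mul_cancel₀ hr.ne']

end Sphere

/-! ### Ball and tube bounds for the model spaces -/

/-- No curve is shorter than the distance between its ends. Finiteness of the intrinsic distance is
needed because `toReal` sends `∞` to `0`. -/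
lemma dist_le_riemannianSphere_dist {E : Type u} [NormedAddCommGroup E] [InnerProductSpace ℝ E]
    [MeasurableSpace E] [BorelSpace E] [FiniteDimensional ℝ E]
    (hE : 2 ≤ Module.finrank ℝ E) {r : ℝ} (hr : 0 < r) (x y : Sph E r) :
    dist x y ≤ @dist (riemannianSphere hE hr).carrier _ x y := by
  have hfin : intrinsicEDist x y ≠ ∞ := ((sphere_intrinsicEDist_le hE hr x y).trans_lt
    (ENNReal.mul_lt_top ENNReal.coe_lt_top (edist_lt_top x y))).ne
  rw [dist_edist]
  exact ENNReal.toReal_mono hfin (edist_le_intrinsicEDist x y)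

lemma sphereMeasure_real_tube_le {n : ℕ+} {r ρ : ℝ} (hr : 0 < r) (hρ : ρ ≤ r / 4)
    (x : Sph (EuclideanSpace ℝ (Fin (n + 1))) r) :
    sphereMeasure hr (Metric.closedBall x ρ) ≤ (n : ℝ≥0∞)⁻¹ := by
  refine (measure_mono ?_).trans ((sphereMeasure_tube_le ℝ (two_le_finrank_real n) hr x).trans ?_)
  · intro y hy
    -- A ball lies in the tube around `±x`; the scalar `1` suffices.
    refine ⟨1, by simp, ?_⟩
    rw [one_smul, dist_comm]
    exact le_trans hy hρ
  · simp

lemma sphereMeasure_complex_tube_le {n : ℕ+} {r ρ : ℝ} (hr : 0 < r) (hρ : ρ ≤ r / 4)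
    (x : Sph (EuclideanSpace ℂ (Fin (n + 1))) r) :
    sphereMeasure hr {y | ∃ z : Circle, dist x (z • y) ≤ ρ} ≤ (n : ℝ≥0∞)⁻¹ := by
  refine (measure_mono ?_).trans
    ((sphereMeasure_tube_le ℂ (two_le_finrank_complex n) hr x).trans ?_)
  · rintro y ⟨z, hz⟩
    exact ⟨z, Circle.norm_coe z, le_trans hz hρ⟩
  -- The dimension over `ℂ` is `n + 1`, and its inverse is at most that of `n`.
  · simp

end MMGeom

open MMGeom

theorem mainTheorem10 (r : ℕ+ → ℝ) (hr : ∀ n, 0 < r n) (hc : ∃ c : ℝ, 0 < c ∧ ∀ n, c ≤ r n) :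
    ¬ MMGeom.HasBoxConvergentSubseq (fun n => MMGeom.sphereEuc n (r n) (hr n)) ∧
    ¬ MMGeom.HasBoxConvergentSubseq (fun n => MMGeom.sphereRiem n (r n) (hr n)) ∧
    ¬ MMGeom.HasBoxConvergentSubseq (fun n => MMGeom.projEuc n (r n) (hr n)) ∧
    ¬ MMGeom.HasBoxConvergentSubseq (fun n => MMGeom.projRiem n (r n) (hr n)) := by
  obtain ⟨c, hc0, hc⟩ := hc
  have hr4 : ∀ n, c / 4 ≤ r n / 4 := fun n => by linarith [hc n]
  -- The quotient balls get a smaller radius to leave the strict gap used in passing to tubes.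
  have h8 : c / 8 < c / 4 := by linarith
  refine ⟨not_hasBoxConvergentSubseq (ρ := c / 4) (by positivity) fun n x => ?_,
    not_hasBoxConvergentSubseq (ρ := c / 4) (by positivity) fun n x => ?_,
    not_hasBoxConvergentSubseq (ρ := c / 8) (by positivity) fun n a => ?_,
    not_hasBoxConvergentSubseq (ρ := c / 8) (by positivity) fun n a => ?_⟩
  · exact sphereMeasure_real_tube_le (hr n) (hr4 n) x
  · refine (measure_mono ?_).trans (sphereMeasure_real_tube_le (hr n) (hr4 n) x)
    intro y hy
    exact (dist_le_riemannianSphere_dist (two_le_finrank_real n) (hr n) y x).trans hy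
  -- The instances are restated exactly as in `projEuc`, so that the quotients agree definitionally.
  · have : CompactSpace (oddSphereEuc n (r n) (hr n)).carrier :=
      inferInstanceAs (CompactSpace (Sph (EuclideanSpace ℂ (Fin (n + 1))) (r n)))
    let _ : MulAction Circle (oddSphereEuc n (r n) (hr n)).carrier := hopfAction (n + 1) (r n)
    exact measure_closedBall_quotient_le (oddSphereEuc n (r n) (hr n)) Circle _ _ h8
      (fun x => sphereMeasure_complex_tube_le (hr n) (hr4 n) x) a
  · have : CompactSpace (oddSphereRiem n (r n) (hr n)).carrier :=
      inferInstanceAs (CompactSpace (Sph (EuclideanSpace ℂ (Fin (n + 1))) (r n)))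
    let _ : MulAction Circle (oddSphereRiem n (r n) (hr n)).carrier := hopfAction (n + 1) (r n)
    refine measure_closedBall_quotient_le (oddSphereRiem n (r n) (hr n)) Circle _ _ h8
      (fun x => (measure_mono ?_).trans (sphereMeasure_complex_tube_le (hr n) (hr4 n) x)) a
    rintro y ⟨z, hz⟩
    exact ⟨z, (dist_le_riemannianSphere_dist (two_le_finrank_complex n) (hr n) x _).trans hz⟩
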